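/- Let $X$ be a complex Banach space. A *contraction semigroup* on $X$ is a family $T=\{T_t:t\ge 0\}$ of bounded operators with $T_{s+t}=T_sT_t$ and $\|T_t\|\le 1$ for $s,t\ge0$ and such that $t\mapsto T_tx$ is norm-continuous on $[0,\infty)$ for every $x\in X$ (so $T_0$ is an idempotent, not necessarily $\mathbf 1$). It is *locally finite* if for every $x\in X$ the norm-closure of the orbit $\{T_tx:t\ge0\}$ is compact. A *quasiautomorphism* is an operator $Q$ with $\|Q\|\le1$ whose restriction to its range $QX$ is an invertible isometry of $QX$ onto itself. A *semigroup of quasiautomorphisms* is a contraction semigroup $S$ such that every $S_t$, $t\ge0$, is a quasiautomorphism. For a contraction semigroup $T$ let $\sigma_p(T)$ be the set of all $\lambda\in\mathbb C$ for which there is a nonzero vector $x$ with $T_tx=e^{it\lambda}x$ for all $t\ge0$; such an $x$ is called an *eigenvector* of $T$, and it is called *maximal* if moreover $\|T_tx\|=\|x\|$ for all $t\ge0$. The *generator* of $T$ is the operator $Ax=\lim_{t\to0+}\frac1{it}(T_tx-x)$, defined for those $x$ for which the limit exists; it is *diagonalized* by a set $G$ if the elements of $G$ are eigenvectors of $A$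 and the closed linear span of $G$ is the whole space. The *set of strong limit points* of $T$ is $$\mathcal L=\bigcap_{\alpha>0}\overline{\{T_t:t\ge\alpha\}}^{\,\mathrm{strong}},$$ the closures being taken in the strong operator topology. **Theorem.** Let $T=\{T_t:t\ge0\}$ be a locally finite contraction semigroup on a complex Banach space $X$ with $T_0=\mathbf 1$. Then there is a unique semigroup $S=\{S_t:t\ge0\}$ of quasiautomorphisms such that $$\lim_{t\to\infty}\|T_tx-S_tx\|=0,\qquad x\in X.$$ Let $E=S_0$ and let $U_t$ be the restriction of $S_t$ to $EX$. Then: 1. $S_tX=EX$, $U_t$ is an invertible isometry of $EX$ onto itself, and $S_t=U_tE$ for all $t\ge0$. 2. The maximal eigenvectors of $U$ are exactly the maximal eigenvectors of $T$, and the generator of the semigroup $U$ on $EX$ is diagonalized by them; in particular $EX$ is their closed linear span. 3. The set of eigenvalues of the generator of $U$ is $\sigma_p(U)$, and $\sigma_p(U)=\sigma_p(T)\cap\mathbb R$. 4. $E$ is the unique idempotent in $\mathcal L$. 5. $U_t$ is the restriction of $T_t$ to $EX$, and $S_t=T_tE$, for all $t\ge0$. -/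

import Mathlib

open Filter Topology
open scoped NNReal

/-- A strongly continuous one-parameter semigroup `{T_t : t ≥ 0}` of contractions on a complex
normed space.  It is *not* required that `T_0 = 1`; in general `T_0` is an idempotent. -/
structure ContractionSemigroup (X : Type*) [NormedAddCommGroup X] [NormedSpace ℂ X] where
  /-- the operators `T_t` -/
  toFun : ℝ≥0 → X →L[ℂ] X
  map_add' : ∀ s t, toFun (s + t) = (toFun s).comp (toFun t)
  norm_le_one' : ∀ t, ‖toFun t‖ ≤ 1
  continuous' : ∀ x, Continuous fun t => toFun t x

/-- A quasiautomorphism: a contraction whose restriction to its range is an automorphism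
(i.e. a surjective linear isometry) of that range. -/
def IsQuasiautomorphism {X : Type*} [NormedAddCommGroup X] [NormedSpace ℂ X]
    (Q : X →L[ℂ] X) : Prop :=
  ‖Q‖ ≤ 1 ∧ ∃ V : Q.range ≃ₗᵢ[ℂ] Q.range, ∀ y : Q.range, (V y : X) = Q y

/-- The closure of a set of bounded operators in the strong operator topology. -/
def strongClosure {X : Type*} [NormedAddCommGroup X] [NormedSpace ℂ X]
    (A : Set (X →L[ℂ] X)) : Set (X →L[ℂ] X) :=
  (ContinuousLinearMap.toPointwiseConvergenceCLM ℂ (RingHom.id ℂ) X X) ⁻¹'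
    closure ((ContinuousLinearMap.toPointwiseConvergenceCLM ℂ (RingHom.id ℂ) X X) '' A)

/-- The set of eigenvalues of a (possibly unbounded) operator. -/
def LinearPMap.pointSpectrum {X : Type*} [NormedAddCommGroup X] [NormedSpace ℂ X]
    (A : X →ₗ.[ℂ] X) : Set ℂ :=
  {z | ∃ x : A.domain, x ≠ 0 ∧ A x = z • (x : X)}

/-- `A` is diagonalized by the set `G`: the elements of `G` are eigenvectors of `A`, and their
linear span is dense. -/
def LinearPMap.IsDiagonalizedBy {X : Type*} [NormedAddCommGroup X] [NormedSpace ℂ X]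
    (A : X →ₗ.[ℂ] X) (G : Set X) : Prop :=
  (∀ x ∈ G, x ≠ 0 ∧ ∃ hx : x ∈ A.domain, ∃ z : ℂ, A ⟨x, hx⟩ = z • x) ∧
    (Submodule.span ℂ G).topologicalClosure = ⊤

namespace ContractionSemigroup

variable {X : Type*} [NormedAddCommGroup X] [NormedSpace ℂ X]

instance : CoeFun (ContractionSemigroup X) fun _ => ℝ≥0 → X →L[ℂ] X := ⟨toFun⟩

/-- Every orbit is relatively norm-compact. -/
def IsLocallyFinite (T : ContractionSemigroup X) : Prop :=
  ∀ x, IsCompact (closure (Set.range fun t => T t x))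

/-- The set of strong limit points of `T_t` as `t → ∞`. -/
def strongLimitPoints (T : ContractionSemigroup X) : Set (X →L[ℂ] X) :=
  ⋂ (α : ℝ≥0) (_ : 0 < α), strongClosure (T.toFun '' Set.Ici α)

/-- `x` is a nonzero vector with `T_t x = e^{itz} x` for all `t ≥ 0`. -/
def IsEigenvector (T : ContractionSemigroup X) (z : ℂ) (x : X) : Prop :=
  x ≠ 0 ∧ ∀ t : ℝ≥0, T t x = Complex.exp (Complex.I * ((t : ℝ) : ℂ) * z) • x

/-- The point spectrum of the semigroup: all `z` for which `T_t x = e^{itz} x`, `t ≥ 0`, has a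
nonzero solution `x`. -/
def pointSpectrum (T : ContractionSemigroup X) : Set ℂ :=
  {z | ∃ x, T.IsEigenvector z x}

/-- The eigenvectors `x` of the semigroup with `‖T_t x‖ = ‖x‖` for all `t ≥ 0`. -/
def maximalEigenvectors (T : ContractionSemigroup X) : Set X :=
  {x | (∃ z, T.IsEigenvector z x) ∧ ∀ t, ‖T t x‖ = ‖x‖}

/-- `y` is the limit of `(it)⁻¹ (T_t x - x)` as `t → 0+`. -/
def HasGeneratorValue (T : ContractionSemigroup X) (x y : X) : Prop :=
  Tendsto (fun t : ℝ≥0 => (Complex.I * ((t : ℝ) : ℂ))⁻¹ • (T t x - x)) (𝓝[>] 0) (𝓝 y)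

theorem HasGeneratorValue.add {T : ContractionSemigroup X} {x y x' y' : X}
    (h : T.HasGeneratorValue x y) (h' : T.HasGeneratorValue x' y') :
    T.HasGeneratorValue (x + x') (y + y') := by
  unfold HasGeneratorValue at *
  refine (Tendsto.add h h').congr fun t => ?_
  rw [← smul_add, map_add]
  congr 1
  abel

theorem HasGeneratorValue.smul {T : ContractionSemigroup X} {x y : X} (c : ℂ)
    (h : T.HasGeneratorValue x y) : T.HasGeneratorValue (c • x) (c • y) := by
  unfold HasGeneratorValue at *
  refine (Tendsto.const_smul h c).congr fun t => ?_
  rw [smul_comm, map_smul, smul_sub]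

theorem HasGeneratorValue.unique {T : ContractionSemigroup X} {x y y' : X}
    (h : T.HasGeneratorValue x y) (h' : T.HasGeneratorValue x y') : y = y' :=
  tendsto_nhds_unique h h'

/-- The generator `A` of the semigroup, `A x = lim_{t → 0+} (it)⁻¹ (T_t x - x)` on the space of
all `x` for which this limit exists.  It is normalized so that formally `T_t = e^{itA}`, whence
`T_t x = e^{itz} x` for all `t` corresponds to `A x = z x`. -/
noncomputable def generator (T : ContractionSemigroup X) : X →ₗ.[ℂ] X where
  domain :=
    { carrier := {x | ∃ y, T.HasGeneratorValue x y}
      add_mem' := fun ⟨_, h⟩ ⟨_, h'⟩ => ⟨_, h.add h'⟩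
      zero_mem' := ⟨0, by simp [HasGeneratorValue]⟩
      smul_mem' := fun c _ ⟨_, h⟩ => ⟨_, h.smul c⟩ }
  toFun :=
    { toFun := fun x => Classical.choose x.2
      map_add' := fun x x' =>
        (Classical.choose_spec (x + x').2).unique
          ((Classical.choose_spec x.2).add (Classical.choose_spec x'.2))
      map_smul' := fun c x =>
        (Classical.choose_spec (c • x).2).unique ((Classical.choose_spec x.2).smul c) }

/-- The restrictions `U_t` of the operators `S_t` of a contraction semigroup to the range of the
idempotent `S_0` (which they leave invariant). -/
def onRange (S : ContractionSemigroup X) : ContractionSemigroup (S 0).range where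
  toFun t := (S t).restrict (p := (S 0).range) (q := (S 0).range) (by
    rintro _ ⟨x, rfl⟩
    refine ⟨S t x, ?_⟩
    have h : (S 0).comp (S t) = (S t).comp (S 0) := by
      rw [← S.map_add', ← S.map_add', add_comm]
    exact congrArg (fun L : X →L[ℂ] X => L x) h)
  map_add' s t := by
    ext y
    exact congrArg (fun L : X →L[ℂ] X => L y) (S.map_add' s t)
  norm_le_one' t := ContinuousLinearMap.opNorm_le_bound _ zero_le_one fun y => by
    have h := (S t).le_of_opNorm_le (S.norm_le_one' t) (y : X)
    exact h
  continuous' y := (S.continuous' y).subtype_mk _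

end ContractionSemigroup

/-! Orbit norms decrease, so `T t x` tends to 0 as soon as it does along one ultrafilter at
infinity. Hence all strong limit points have the same kernel, the vectors with vanishing orbit
(`apply_eq_zero_iff_tendsto`); they also commute. Compact orbits supply limits along an ultrafilter:
`P = lim T t` and `R s = lim T (t - s)`, with `P = T s ∘ R s`. A limit `E` of the `R s` satisfies `P
E = P`, so `x - E x` lies in the common kernel and `E` is idempotent. Commuting idempotents with one
kernel coincide, whence uniqueness. The semigroup `T t ∘ E` is asymptotic to `T` because `x - E x`
has vanishing orbit. On the range of `E`, `T t` is isometric, since `x` is a limit point of its own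
orbit, and onto (`IsLocallyFinite.exists_apply_eq`). Conversely, any admissible `S` is isometric on
the range of `S 0`; this forces `ker (S 0) = ker E`, then `S 0 = E` (`zero_eq_and_eq_comp`).

For the diagonalization, `U` extends to an isometric action of `ℝ` with totally bounded orbits.
Completing `ℝ` for the seminorm `‖ρ a y - y‖` gives a compact group on which the orbit map of `y`
lives. A functional killing all common eigenvectors becomes a function on this group orthogonal to
every translation eigenvector in `L²`; the spectral theorem for a compact averaged operator shows
that it vanishes, and Hahn–Banach concludes. The scalars on a common eigenvector form a continuous
multiplicative function, hence an exponential. -/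

open MeasureTheory

/-! ### Common eigenvectors in finite dimension -/

/-- Commuting operators leaving a nonzero finite-dimensional subspace invariant have a common
eigenvector in it. -/
theorem exists_common_eigenvector {ι V : Type*} [AddCommGroup V] [Module ℂ V]
    (f : ι → V →ₗ[ℂ] V) (hf : ∀ i j v, f i (f j v) = f j (f i v)) (W : Submodule ℂ V)
    [FiniteDimensional ℂ W] (hW : W ≠ ⊥) (hfW : ∀ i, ∀ v ∈ W, f i v ∈ W) :
    ∃ v ∈ W, v ≠ 0 ∧ ∀ i, ∃ c : ℂ, f i v = c • v := by
  induction hn : Module.finrank ℂ W using Nat.strong_induction_on generalizing W with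
  | _ n ih =>
    by_cases hscal : ∀ i, ∃ c : ℂ, ∀ v ∈ W, f i v = c • v
    · obtain ⟨v, hvW, hv0⟩ := W.ne_bot_iff.mp hW
      exact ⟨v, hvW, hv0, fun i => (hscal i).imp fun c hc => hc v hvW⟩
    -- Some `f i` is not scalar on `W`, so one of its eigenspaces in `W` is proper and nonzero;
    -- commutation makes it invariant, and the dimension has dropped.
    · push Not at hscal
      obtain ⟨i, hi⟩ := hscal
      have : Nontrivial W := Submodule.nontrivial_iff_ne_bot.mpr hW
      obtain ⟨c, hc⟩ := Module.End.exists_eigenvalue ((f i).restrict (hfW i))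
      obtain ⟨w, hw⟩ := hc.exists_hasEigenvector
      let W' : Submodule ℂ V := W ⊓ LinearMap.ker (f i - c • LinearMap.id)
      have hmem : ∀ v, v ∈ W' ↔ v ∈ W ∧ f i v = c • v := by
        intro v
        simp [W', sub_eq_zero]
      have hlt : W' < W := by
        refine lt_of_le_of_ne inf_le_left fun h => ?_
        obtain ⟨v, hvW, hv⟩ := hi c
        exact hv ((hmem v).mp (h ▸ hvW)).2
      have : FiniteDimensional ℂ W' := Submodule.finiteDimensional_of_le hlt.le
      have hne : W' ≠ ⊥ := by
        refine W'.ne_bot_iff.mpr ⟨w, (hmem _).mpr ⟨w.2, ?_⟩, fun h => hw.2 (Subtype.ext h)⟩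
        exact congrArg Subtype.val hw.apply_eq_smul
      obtain ⟨v, hv, hv0, hve⟩ := ih _ (hn ▸ Submodule.finrank_lt_finrank_of_lt hlt) W' hne
        (fun j v hv => (hmem _).mpr ⟨hfW j v ((hmem v).mp hv).1, by
          rw [hf, ((hmem v).mp hv).2, map_smul]⟩) rfl
      exact ⟨v, ((hmem v).mp hv).1, hv0, hve⟩

/-- Continuity in operator norm makes the averaged operator a Bochner integral of operators, so that
compactness passes to it. -/
theorem continuous_rankOne_self {G H : Type*} [TopologicalSpace G] [NormedAddCommGroup H]
    [InnerProductSpace ℂ H] {f : G → H} (hf : Continuous f) :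
    Continuous fun a => InnerProductSpace.rankOne ℂ (f a) (f a) :=
  ((ContinuousLinearMap.smulRightL ℂ H H).continuous.comp
    ((innerSL ℂ (E := H)).continuous.comp hf)).clm_apply hf

/-! ### Unitary representations of compact abelian groups -/

section UnitaryRepresentation

variable {G : Type*} [AddCommGroup G] [TopologicalSpace G] [CompactSpace G]
  [MeasurableSpace G] [BorelSpace G] {μ : Measure G} [μ.IsAddHaarMeasure]
  {H : Type*} [NormedAddCommGroup H] [InnerProductSpace ℂ H]
  {τ : G → H ≃ₗᵢ[ℂ] H} {f : H}

open InnerProductSpace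

variable (μ τ f) in
/-- The average of the rank-one operators along the orbit of `f`. -/
noncomputable def averagedRankOne : H →L[ℂ] H := ∫ a, rankOne ℂ (τ a f) (τ a f) ∂μ

theorem averagedRankOne_apply (hc : Continuous fun a => τ a f) (g : H) :
    averagedRankOne μ τ f g = ∫ a, inner ℂ (τ a f) g • τ a f ∂μ := by
  have h := ContinuousLinearMap.integral_apply (μ := μ)
    ((continuous_rankOne_self hc).integrable_of_hasCompactSupport
      (HasCompactSupport.of_compactSpace _)) g
  simpa [averagedRankOne] using h

variable [CompleteSpace H]

theorem inner_averagedRankOne (hc : Continuous fun a => τ a f) (g h : H) :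
    inner ℂ h (averagedRankOne μ τ f g) = ∫ a, inner ℂ (τ a f) g * inner ℂ h (τ a f) ∂μ := by
  rw [averagedRankOne_apply hc, ← integral_inner]
  · simp_rw [inner_smul_right]
  · refine Continuous.integrable_of_hasCompactSupport ?_ (HasCompactSupport.of_compactSpace _)
    exact (hc.inner continuous_const).smul hc

theorem isSymmetric_averagedRankOne (hc : Continuous fun a => τ a f) :
    (averagedRankOne μ τ f).IsSymmetric := by
  intro g h
  rw [← inner_conj_symm]
  erw [inner_averagedRankOne hc, inner_averagedRankOne hc]
  rw [← integral_conj]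
  simp [mul_comm]

/-- Compact operators form a closed convex set, which contains every average of rank-one operators
over a probability measure. -/
theorem isCompactOperator_averagedRankOne [IsProbabilityMeasure μ]
    (hc : Continuous fun a => τ a f) :
    IsCompactOperator (averagedRankOne μ τ f) := by
  have hconv : Convex ℝ {B : H →L[ℂ] H | IsCompactOperator B} :=
    ((compactOperator (RingHom.id ℂ) H H).restrictScalars ℝ).convex
  refine hconv.integral_mem (μ := μ) isClosed_setOfPred_isCompactOperator
    (Eventually.of_forall fun a => ?_)
    ((continuous_rankOne_self hc).integrable_of_hasCompactSupport
      (HasCompactSupport.of_compactSpace _))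
  have h := IsCompactOperator.comp_clm (isCompactOperator_of_locallyCompactSpace_rng
    (ContinuousLinearMap.toSpanSingleton ℂ (τ a f))) (innerSL ℂ (τ a f))
  exact h

/-- Substitute `s + a` for `a` by invariance of the measure; unitarity of `τ s` cancels it in the
inner product. -/
theorem averagedRankOne_comm [IsTopologicalAddGroup G]
    (hτ : ∀ a b x, τ (a + b) x = τ a (τ b x))
    (hc : Continuous fun a => τ a f) (s : G) (g : H) :
    averagedRankOne μ τ f (τ s g) = τ s (averagedRankOne μ τ f g) := by
  rw [averagedRankOne_apply hc, averagedRankOne_apply hc]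
  have h := (τ s).toContinuousLinearEquiv.toContinuousLinearMap.integral_comp_comm (μ := μ)
    (φ := fun a => inner ℂ (τ a f) g • τ a f)
    (Continuous.integrable_of_hasCompactSupport ((hc.inner continuous_const).smul hc)
      (HasCompactSupport.of_compactSpace _))
  refine Eq.trans ?_ h
  rw [← integral_add_left_eq_self _ s]
  refine integral_congr_ae (Eventually.of_forall fun a => ?_)
  simp [hτ]

/-- Pairing with `f` gives the integral of the continuous function `‖⟪τ a f, f⟫‖ ^ 2`, which is
positive at `a = 0` unless `f = 0`. -/
theorem eq_zero_of_averagedRankOne_apply_self (hc : Continuous fun a => τ a f) (h0 : τ 0 f = f)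
    (h : averagedRankOne μ τ f f = 0) : f = 0 := by
  have h1 : ∫ a, ‖inner ℂ (τ a f) f‖ ^ 2 ∂μ = 0 := by
    have h2 := inner_averagedRankOne (μ := μ) hc f f
    rw [h, inner_zero_right] at h2
    have h3 : ∀ a, inner ℂ (τ a f) f * inner ℂ f (τ a f) =
        ((‖inner ℂ (τ a f) f‖ ^ 2 : ℝ) : ℂ) := fun a => by
      rw [← inner_conj_symm f, RCLike.mul_conj]
      simp
    simp_rw [h3] at h2
    exact Complex.ofReal_eq_zero.mp (h2.trans (integral_ofReal (𝕜 := ℂ))).symm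
  by_contra hf
  have hcont : Continuous fun a => ‖inner ℂ (τ a f) f‖ ^ 2 := (hc.inner continuous_const).norm.pow 2
  refine (Continuous.integral_pos_of_hasCompactSupport_nonneg_nonzero (μ := μ) hcont
    (HasCompactSupport.of_compactSpace _) (fun a => by positivity) (x := 0) ?_).ne' h1
  simpa [h0] using hf

/-- A vector orthogonal to all common eigenvectors of a unitary representation of a compact abelian
group vanishes. -/
theorem eq_zero_of_forall_common_eigenvector_inner_eq_zero [IsTopologicalAddGroup G]
    (μ : Measure G) [μ.IsAddHaarMeasure]
    [IsProbabilityMeasure μ]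
    (hτ : ∀ a b x, τ (a + b) x = τ a (τ b x)) (hc : Continuous fun a => τ a f)
    (hf : ∀ h, h ≠ 0 → (∀ a, ∃ c : ℂ, τ a h = c • h) → inner ℂ h f = 0) : f = 0 := by
  let B := averagedRankOne μ τ f
  have hB : ∀ s g, B (τ s g) = τ s (B g) := averagedRankOne_comm hτ hc
  have hsymm : B.IsSymmetric := isSymmetric_averagedRankOne hc
  have h0 : ∀ x, τ 0 x = x := fun x => (τ 0).injective (by rw [← hτ, add_zero])
  let Z : Set H := {h | ∀ a, ∃ c : ℂ, τ a h = c • h}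
  let N : Submodule ℂ H := (Submodule.span ℂ Z)ᗮ
  have hN : ∀ x, x ∈ N ↔ ∀ h ∈ Z, inner ℂ h x = 0 := fun x => by
    refine ⟨fun hx h hh => Submodule.mem_orthogonal _ _ |>.mp hx h (Submodule.subset_span hh),
      fun hx => (Submodule.mem_orthogonal _ _).mpr fun u hu => ?_⟩
    induction hu using Submodule.span_induction with
    | mem u hu => exact hx u hu
    | zero => simp
    | add u v _ _ hu hv => simp [inner_add_left, hu, hv]
    | smul c u _ hu => simp [inner_smul_left, hu]
  have hfN : f ∈ N := (hN f).mpr fun h hh => by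
    by_cases h0 : h = 0
    · simp [h0]
    · exact hf h h0 hh
  have hBN : ∀ x ∈ N, B x ∈ N := fun x hx => (hN _).mpr fun h hh => by
    have h1 : inner ℂ (B h) x = 0 := (hN x).mp hx _ fun a => by
      obtain ⟨c, hc⟩ := hh a
      exact ⟨c, by rw [← hB, hc, map_smul]⟩
    rw [← h1]
    exact (hsymm h x).symm
  have hτN : ∀ a, ∀ x ∈ N, τ a x ∈ N := fun a x hx => (hN _).mpr fun h hh => by
    obtain ⟨c, hc⟩ := hh (-a)
    have h1 : inner ℂ (τ (-a) h) (τ (-a) (τ a x)) = 0 := by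
      rw [← hτ, neg_add_cancel, h0, hc, inner_smul_left, (hN x).mp hx h hh, mul_zero]
    rwa [(τ (-a)).inner_map_map] at h1
  let S : N →L[ℂ] N := B.restrict hBN
  have hScomp : IsCompactOperator S :=
    (isCompactOperator_averagedRankOne (μ := μ) hc).restrict' hBN
  have hSsymm : S.IsSymmetric := hsymm.restrict_invariant hBN
  -- A nonzero eigenvalue of `S` has a finite-dimensional eigenspace invariant under every `τ a`. It
  -- would contain a common eigenvector, which, lying in `N`, is orthogonal to itself.
  have hS : S = 0 := by
    rw [← ContinuousLinearMap.eq_zero_of_forall_hasEigenvalue_eq_zero hScomp hSsymm]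
    intro z hz
    by_contra hz0
    have hfin := ContinuousLinearMap.finite_dimensional_eigenspace hScomp z hz0
    have hcomm : ∀ a (x : N), S ⟨τ a x, hτN a x x.2⟩ = ⟨τ a (S x), hτN a _ (S x).2⟩ :=
      fun a x => Subtype.ext (hB a x)
    obtain ⟨v, -, hv0, hv⟩ := exists_common_eigenvector
      (fun a => (τ a).toLinearEquiv.toLinearMap.restrict (hτN a))
      (fun a b v => Subtype.ext <| by
        change τ a (τ b v) = τ b (τ a v)
        rw [← hτ, ← hτ, add_comm])
      (Module.End.eigenspace S.toLinearMap z) hz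
      (fun a v hv => by
        rw [Module.End.mem_eigenspace_iff] at hv ⊢
        refine (hcomm a v).trans (Subtype.ext ?_)
        have hv' : S v = z • v := hv
        simp [hv'])
    have h1 : inner ℂ (v : H) v = 0 := (hN v).mp v.2 v fun a =>
      (hv a).imp fun c hc => congrArg Subtype.val hc
    exact hv0 (Subtype.ext (inner_self_eq_zero.mp h1))
  refine eq_zero_of_averagedRankOne_apply_self (μ := μ) hc (h0 f) ?_
  exact congrArg Subtype.val (DFunLike.congr_fun hS ⟨f, hfN⟩)

end UnitaryRepresentation

/-! ### Translations on `L²` -/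

section Translation

variable {G : Type*} [AddCommGroup G] [TopologicalSpace G] [IsTopologicalAddGroup G]
  [MeasurableSpace G] [BorelSpace G] (μ : Measure G) [μ.IsAddHaarMeasure]

/-- Translation by `a` on `L²` of an abelian group. -/
noncomputable def lpTranslation (a : G) : Lp ℂ 2 μ ≃ₗᵢ[ℂ] Lp ℂ 2 μ :=
  LinearIsometryEquiv.ofSurjective
    (Lp.compMeasurePreservingₗᵢ ℂ (· + a) (measurePreserving_add_right μ a)) fun f => by
      refine ⟨Lp.compMeasurePreserving (· + -a) (measurePreserving_add_right μ (-a)) f, ?_⟩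
      change Lp.compMeasurePreserving (· + a) (measurePreserving_add_right μ a)
        (Lp.compMeasurePreserving _ _ f) = f
      rw [← Lp.compMeasurePreserving_comp_apply]
      have h : ((· + -a) ∘ (· + a) : G → G) = id := by
        ext
        simp
      simp only [h]
      exact Lp.compMeasurePreserving_id_apply f

theorem lpTranslation_apply (a : G) (f : Lp ℂ 2 μ) :
    lpTranslation μ a f = Lp.compMeasurePreserving (· + a) (measurePreserving_add_right μ a) f :=
  rfl

theorem coeFn_lpTranslation (a : G) (f : Lp ℂ 2 μ) :
    lpTranslation μ a f =ᵐ[μ] fun x => f (x + a) :=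
  Lp.coeFn_compMeasurePreserving f _

theorem lpTranslation_add (a b : G) (f : Lp ℂ 2 μ) :
    lpTranslation μ (a + b) f = lpTranslation μ a (lpTranslation μ b f) := by
  simp only [lpTranslation_apply]
  rw [← Lp.compMeasurePreserving_comp_apply]
  congr 2
  ext x
  simp [add_assoc]

end Translation

/-! ### Equivariant maps from a compact group -/

section CompactGroup

variable {G : Type*} [AddCommGroup G] [TopologicalSpace G] [IsTopologicalAddGroup G]
  [CompactSpace G] [SecondCountableTopology G]
  {A Y : Type*} [NormedAddCommGroup Y] [NormedSpace ℂ Y] [CompleteSpace Y]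

/-- If `h` is a translation eigenvector in `L²`, the vector-valued Fourier coefficient `∫ conj h •
Φ` is a common eigenvector of `ρ`, and `φ` maps it to `⟪h, φ ∘ Φ⟫`. So `φ ∘ Φ` is orthogonal to all
such `h`. -/
theorem dual_apply_eq_zero_of_common_eigenvectors (ρ : A → Y ≃ₗᵢ[ℂ] Y) (e : A → G) {Φ : G → Y}
    (hΦ : Continuous Φ) (hρ : ∀ a g, Φ (e a + g) = ρ a (Φ g)) (φ : StrongDual ℂ Y)
    (hφ : ∀ v, (∀ a, ∃ c : ℂ, ρ a v = c • v) → φ v = 0) (g : G) : φ (Φ g) = 0 := by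
  borelize G
  let μ : Measure G := Measure.addHaarMeasure ⊤
  have : IsProbabilityMeasure μ := ⟨by
    simpa using Measure.addHaarMeasure_self (G := G) (K₀ := ⊤)⟩
  let F : C(G, ℂ) := ⟨fun x => φ (Φ x), φ.continuous.comp hΦ⟩
  let f : Lp ℂ 2 μ := ContinuousMap.toLp 2 μ ℂ F
  have hfF : f =ᵐ[μ] F := ContinuousMap.coeFn_toLp μ F
  suffices hf : f = 0 by
    have hF : F = 0 := ContinuousMap.toLp_injective (p := 2) (𝕜 := ℂ) μ
      (show f = _ by rw [hf, map_zero])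
    exact DFunLike.congr_fun hF g
  refine eq_zero_of_forall_common_eigenvector_inner_eq_zero μ (lpTranslation_add μ) ?_ ?_
  · exact Continuous.compMeasurePreservingLp (Z := G) (f := fun _ => f)
      (g := fun a => ⟨(· + a), by fun_prop⟩) continuous_const
      (ContinuousMap.continuous_of_continuous_uncurry _
        (continuous_snd.add continuous_fst))
      (measurePreserving_add_right μ) (by simp)
  · intro h _ hh
    have hint : Integrable (fun x => starRingEnd ℂ (h x) • Φ x) μ := by
      have h1 : Integrable (fun x => starRingEnd ℂ (h x)) μ :=
        (Lp.memLp h).star.integrable (by norm_num)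
      obtain ⟨C, hC⟩ := (isCompact_range hΦ).isBounded.exists_norm_le
      exact h1.smul_bdd C hΦ.aestronglyMeasurable
        (Eventually.of_forall fun x => hC _ (Set.mem_range_self x))
    have hv := hφ (∫ x, starRingEnd ℂ (h x) • Φ x ∂μ) fun a => by
      -- Absorbing `ρ a` into the argument of `Φ` shifts `h` by `-e a`; its eigenvalue comes out
      -- conjugated.
      obtain ⟨c, hc⟩ := hh (-e a)
      refine ⟨starRingEnd ℂ c, ?_⟩
      have h2 := (ρ a).toContinuousLinearEquiv.toContinuousLinearMap.integral_comp_comm hint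
      refine h2.symm.trans ?_
      rw [← integral_add_left_eq_self _ (-e a), ← integral_smul]
      refine integral_congr_ae ?_
      have h3 : (fun x => h (x + -e a)) =ᵐ[μ] fun x => c • h x :=
        (coeFn_lpTranslation μ (-e a) h).symm.trans (hc ▸ Lp.coeFn_smul c h)
      filter_upwards [h3] with x hx
      have h4 : ρ a (Φ (-e a + x)) = Φ x := by rw [← hρ, add_neg_cancel_left]
      simp [add_comm _ x, hx, mul_smul] at h4 ⊢
      rw [h4]
    rw [L2.inner_def]
    rw [← φ.integral_comp_comm hint] at hv
    rw [← hv]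
    refine integral_congr_ae ?_
    filter_upwards [hfF] with x hx
    simp [hx, F, mul_comm]

end CompactGroup

/-! ### Totally bounded orbits and compact completions -/

section OrbitCompletion

variable {A Y : Type*} [AddCommGroup A] [NormedAddCommGroup Y] [NormedSpace ℂ Y]

/-- The seminorm `a ↦ ‖ρ a y - y‖` of an isometric action. -/
def orbitSeminorm (ρ : A → Y ≃ₗᵢ[ℂ] Y) (hρ : ∀ a b x, ρ (a + b) x = ρ a (ρ b x)) (y : Y) :
    AddGroupSeminorm A where
  toFun a := ‖ρ a y - y‖
  map_zero' := by
    have h : ρ 0 y = y := (ρ 0).injective (by rw [← hρ, add_zero])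
    simp [h]
  add_le' a b := by
    have h : ρ (a + b) y - y = ρ a (ρ b y - y) + (ρ a y - y) := by
      rw [hρ, map_sub, sub_add_sub_cancel]
    rw [h, add_comm]
    exact (norm_add_le _ _).trans_eq (by rw [(ρ a).norm_map])
  neg' a := by
    have h : ρ a (ρ (-a) y - y) = -(ρ a y - y) := by
      have h : ρ 0 y = y := (ρ 0).injective (by rw [← hρ, add_zero])
      rw [map_sub, ← hρ, add_neg_cancel, h, neg_sub]
    rw [← (ρ a).norm_map, h, norm_neg]

variable [CompleteSpace Y]

/-- A vector with totally bounded orbit under an abelian group of isometries lies in the closed span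
of the common eigenvectors. -/
theorem mem_closure_span_common_eigenvectors (ρ : A → Y ≃ₗᵢ[ℂ] Y)
    (hρ : ∀ a b x, ρ (a + b) x = ρ a (ρ b x)) (y : Y)
    (hy : TotallyBounded (Set.range fun a => ρ a y)) :
    y ∈ (Submodule.span ℂ {v | ∀ a, ∃ c : ℂ, ρ a v = c • v}).topologicalClosure := by
  set M := (Submodule.span ℂ {v | ∀ a, ∃ c : ℂ, ρ a v = c • v}).topologicalClosure with hM
  by_contra hyM
  have : IsClosed (M : Set Y) := Submodule.isClosed_topologicalClosure _
  have hne : ‖M.mkQ y‖ ≠ 0 := by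
    rw [norm_ne_zero_iff]
    simpa using hyM
  obtain ⟨ψ, -, hψ⟩ := exists_dual_vector ℂ (M.mkQ y) hne
  let φ : StrongDual ℂ Y := ψ.comp M.mkQL
  have hφ : ∀ v, (∀ a, ∃ c : ℂ, ρ a v = c • v) → φ v = 0 := fun v hv => by
    have h : M.mkQ v = 0 := (Submodule.Quotient.mk_eq_zero M).mpr
      (Submodule.le_topologicalClosure _ (Submodule.subset_span (Set.mem_ofPred.mpr hv)))
    change ψ (M.mkQ v) = 0
    rw [h, map_zero]
  -- In this seminorm the orbit map is isometric, so `A` inherits total boundedness from the orbit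
  -- and its completion is a compact group.
  let : SeminormedAddCommGroup A := (orbitSeminorm ρ hρ y).toSeminormedAddCommGroup
  have hdist : ∀ a b : A, dist (ρ a y) (ρ b y) = dist a b := fun a b => by
    have h1 : dist a b = ‖ρ (-a + b) y - y‖ := dist_eq_norm_neg_add a b
    rw [h1, dist_comm, dist_eq_norm, ← (ρ (-a)).norm_map, map_sub, ← hρ, ← hρ, neg_add_cancel]
    have h : ρ 0 y = y := (ρ 0).injective (by rw [← hρ, add_zero])
    rw [h]
  have hiso : Isometry fun a => ρ a y := Isometry.of_dist_eq hdist
  have htb : TotallyBounded (Set.univ : Set A) := by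
    have h := totallyBounded_preimage hiso.isUniformInducing hy
    rwa [Set.preimage_range] at h
  let G := UniformSpace.Completion A
  have hG : CompactSpace G := by
    have h1 : TotallyBounded (Set.range ((↑) : A → G)) := by
      rw [← Set.image_univ]
      exact htb.image (UniformSpace.Completion.uniformContinuous_coe A)
    have h2 := h1.closure
    rw [UniformSpace.Completion.denseRange_coe.closure_range] at h2
    exact isCompact_univ_iff.mp (h2.isCompact_of_isClosed isClosed_univ)
  let Φ : G → Y := UniformSpace.Completion.extension fun a => ρ a y
  have hΦ : Continuous Φ := UniformSpace.Completion.continuous_extension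
  have hΦe : ∀ a : A, Φ a = ρ a y :=
    UniformSpace.Completion.extension_coe hiso.uniformContinuous
  have h0 := dual_apply_eq_zero_of_common_eigenvectors ρ ((↑) : A → G) hΦ
    (fun a g => by
      induction g using UniformSpace.Completion.induction_on with
      | hp => exact isClosed_eq (by fun_prop) (by fun_prop)
      | ih b => rw [← UniformSpace.Completion.coe_add, hΦe, hΦe, hρ]) φ hφ ((0 : A) : G)
  have h : ρ 0 y = y := (ρ 0).injective (by rw [← hρ, add_zero])
  rw [hΦe, h] at h0
  have h1 : ψ (M.mkQ y) = 0 := h0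
  rw [h1] at hψ
  exact hne (Complex.ofReal_eq_zero.mp hψ.symm)

end OrbitCompletion

/-! ### Strong limits of contractions -/

section Limits

variable {X : Type*} [NormedAddCommGroup X] [NormedSpace ℂ X]

/-- A family of contractions with values eventually in compact sets converges strongly along every
ultrafilter. -/
theorem exists_strong_limit {ι : Type*} (u : Ultrafilter ι) (f : ι → X →L[ℂ] X)
    (hf : ∀ i, ‖f i‖ ≤ 1) (hK : ∀ x, ∃ K, IsCompact K ∧ ∀ i, f i x ∈ K) :
    ∃ P : X →L[ℂ] X, ‖P‖ ≤ 1 ∧ ∀ x, Tendsto (fun i => f i x) u (𝓝 (P x)) := by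
  have h : ∀ x, ∃ y, Tendsto (fun i => f i x) u (𝓝 y) := fun x => by
    obtain ⟨K, hK, hfK⟩ := hK x
    obtain ⟨y, -, hy⟩ := hK.ultrafilter_le_nhds (u.map fun i => f i x)
      (le_principal_iff.mpr (Filter.mem_map.mpr (Eventually.of_forall hfK)))
    exact ⟨y, hy⟩
  choose P hP using h
  let L : X →ₗ[ℂ] X :=
    { toFun := P
      map_add' := fun x y => tendsto_nhds_unique (hP (x + y))
        (((hP x).add (hP y)).congr fun i => (map_add _ _ _).symm)
      map_smul' := fun c x => tendsto_nhds_unique (hP (c • x))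
        (((hP x).const_smul c).congr fun i => (map_smul _ _ _).symm) }
  have hL : ∀ x, ‖L x‖ ≤ 1 * ‖x‖ := fun x =>
    le_of_tendsto (hP x).norm (Eventually.of_forall fun i => (f i).le_of_opNorm_le (hf i) x)
  exact ⟨L.mkContinuous 1 hL, L.mkContinuous_norm_le zero_le_one hL, hP⟩

/-- Commuting idempotents with the same kernel are equal. -/
theorem eq_of_commute_of_ker_eq {E F : X →L[ℂ] X} (hE : ∀ x, E (E x) = E x)
    (hF : ∀ x, F (F x) = F x) (hEF : ∀ x, E (F x) = F (E x)) (h : ∀ x, E x = 0 ↔ F x = 0) :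
    E = F := by
  ext x
  have h1 : E (x - F x) = 0 := (h _).mpr (by rw [map_sub, hF, sub_self])
  have h2 : F (x - E x) = 0 := (h _).mp (by rw [map_sub, hE, sub_self])
  rw [map_sub, sub_eq_zero] at h1 h2
  rw [h1, hEF, ← h2]

theorem tendsto_toPointwiseConvergenceCLM_iff {ι : Type*} {l : Filter ι} {f : ι → X →L[ℂ] X}
    {P : X →L[ℂ] X} :
    Tendsto (fun i => ContinuousLinearMap.toPointwiseConvergenceCLM ℂ (RingHom.id ℂ) X X (f i)) l
      (𝓝 (ContinuousLinearMap.toPointwiseConvergenceCLM ℂ (RingHom.id ℂ) X X P)) ↔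
    ∀ x, Tendsto (fun i => f i x) l (𝓝 (P x)) := by
  rw [(PointwiseConvergenceCLM.isEmbedding_coeFn (RingHom.id ℂ) X X).tendsto_nhds_iff,
    tendsto_pi_nhds]
  rfl

end Limits

/-! ### Strong limit points, the idempotent and the asymptotic semigroup -/

namespace ContractionSemigroup

variable {X : Type*} [NormedAddCommGroup X] [NormedSpace ℂ X] (T S : ContractionSemigroup X)

theorem add_apply (s t : ℝ≥0) (x : X) : T (s + t) x = T s (T t x) := by
  rw [T.map_add']
  rfl

theorem apply_comm (s t : ℝ≥0) (x : X) : T s (T t x) = T t (T s x) := by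
  rw [← T.add_apply, ← T.add_apply, add_comm]

theorem norm_apply_le (t : ℝ≥0) (x : X) : ‖T t x‖ ≤ ‖x‖ := by
  simpa using (T t).le_of_opNorm_le (T.norm_le_one' t) x

theorem antitone_norm_apply (x : X) : Antitone fun t => ‖T t x‖ := fun s t hst => by
  have h : T t x = T (t - s) (T s x) := by rw [← T.add_apply, tsub_add_cancel_of_le hst]
  simpa only [h] using T.norm_apply_le _ _

variable {T S}

/-- The strong limit points are the cluster points of `T t` at infinity, hence its limits along
ultrafilters finer than `atTop`. -/
theorem mem_strongLimitPoints_iff {F : X →L[ℂ] X} : F ∈ T.strongLimitPoints ↔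
    ∃ u : Ultrafilter ℝ≥0, ↑u ≤ (atTop : Filter ℝ≥0) ∧
      ∀ x, Tendsto (fun t => T t x) u (𝓝 (F x)) := by
  let p := ContinuousLinearMap.toPointwiseConvergenceCLM ℂ (RingHom.id ℂ) X X
  have h1 : F ∈ T.strongLimitPoints ↔ MapClusterPt (p F) atTop fun t => p (T t) := by
    simp only [mapClusterPt_atTop_iff_forall_mem_closure, strongLimitPoints, strongClosure,
      Set.mem_iInter, Set.mem_preimage, Set.image_image]
    refine ⟨fun h α => ?_, fun h α _ => h α⟩
    -- The intersection runs over `α > 0` only; passing to `α + 1` also covers `α = 0`.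
    refine closure_mono (Set.image_mono ?_) (h (α + 1) (by positivity))
    exact Set.Ici_subset_Ici.mpr (by simp)
  rw [h1, mapClusterPt_iff_ultrafilter]
  simp only [p, tendsto_toPointwiseConvergenceCLM_iff]

theorem mem_strongLimitPoints_of_tendsto {ι : Type*} {l : Filter ι} [l.NeBot]
    {f : ι → X →L[ℂ] X} {P : X →L[ℂ] X} (hf : ∀ i, f i ∈ T.strongLimitPoints)
    (h : ∀ x, Tendsto (fun i => f i x) l (𝓝 (P x))) : P ∈ T.strongLimitPoints := by
  simp only [strongLimitPoints, strongClosure, Set.mem_iInter, Set.mem_preimage] at hf ⊢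
  intro α hα
  exact isClosed_closure.mem_of_tendsto (tendsto_toPointwiseConvergenceCLM_iff.mpr h)
    (Eventually.of_forall fun i => hf i α hα)

theorem apply_comm_of_mem_strongLimitPoints {F B : X →L[ℂ] X} (hF : F ∈ T.strongLimitPoints)
    (hB : ∀ t x, B (T t x) = T t (B x)) (x : X) : B (F x) = F (B x) := by
  obtain ⟨u, -, hu⟩ := mem_strongLimitPoints_iff.mp hF
  exact tendsto_nhds_unique (((B.continuous.tendsto _).comp (hu x)).congr fun t => hB t x)
    (hu (B x))

theorem strongLimitPoints_comm {F P : X →L[ℂ] X} (hF : F ∈ T.strongLimitPoints)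
    (hP : P ∈ T.strongLimitPoints) (x : X) : P (F x) = F (P x) :=
  apply_comm_of_mem_strongLimitPoints hF
    (fun t x => (apply_comm_of_mem_strongLimitPoints hP (T.apply_comm t) x).symm) x

/-- Since `‖T t x‖` decreases, smallness at one time persists. The right side does not mention `F`,
so all strong limit points share one kernel. -/
theorem apply_eq_zero_iff_tendsto {F : X →L[ℂ] X} (hF : F ∈ T.strongLimitPoints) (x : X) :
    F x = 0 ↔ Tendsto (fun t => T t x) atTop (𝓝 0) := by
  obtain ⟨u, hu, hF⟩ := mem_strongLimitPoints_iff.mp hF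
  refine ⟨fun h => ?_, fun h => tendsto_nhds_unique (hF x) (h.mono_left hu)⟩
  have h1 := hF x
  rw [h] at h1
  rw [Metric.tendsto_atTop]
  intro ε hε
  obtain ⟨t, ht⟩ := (Metric.tendsto_nhds.mp h1 ε hε).exists
  refine ⟨t, fun s hs => ?_⟩
  rw [dist_zero_right] at ht ⊢
  exact (T.antitone_norm_apply x hs).trans_lt ht

theorem norm_apply_eq_of_mem_strongLimitPoints {F : X →L[ℂ] X} (hF : F ∈ T.strongLimitPoints)
    {x : X} (hx : F x = x) (t : ℝ≥0) : ‖T t x‖ = ‖x‖ := by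
  obtain ⟨u, hu, hF⟩ := mem_strongLimitPoints_iff.mp hF
  refine le_antisymm (T.norm_apply_le t x) ?_
  have h := (hF x).norm
  rw [hx] at h
  refine le_of_tendsto h ?_
  filter_upwards [hu (eventually_ge_atTop t)] with s hs
  exact T.antitone_norm_apply x hs

/-- `R` is the limit of `T (t - s)`; truncated subtraction is harmless because `s ≤ t` eventually.
It acts as a substitute for running the limit backwards by time `s`. -/
theorem IsLocallyFinite.exists_shifted_limit (hT : T.IsLocallyFinite) {u : Ultrafilter ℝ≥0}
    (hu : ↑u ≤ (atTop : Filter ℝ≥0)) (s : ℝ≥0) :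
    ∃ R : X →L[ℂ] X, R ∈ T.strongLimitPoints ∧ ‖R‖ ≤ 1 ∧
      (∀ x, R x ∈ closure (Set.range fun t => T t x)) ∧
      ∀ x, Tendsto (fun t => T t x) u (𝓝 (T s (R x))) := by
  have hmem : ∀ t x, T (t - s) x ∈ closure (Set.range fun t => T t x) := fun t x =>
    subset_closure (Set.mem_range_self _)
  obtain ⟨R, hR1, hR⟩ := exists_strong_limit u (fun t => T (t - s)) (fun t => T.norm_le_one' _)
    fun x => ⟨_, hT x, fun t => hmem t x⟩
  have hsub : Tendsto (fun t : ℝ≥0 => t - s) u atTop := by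
    refine Tendsto.mono_left (tendsto_atTop.mpr fun b => ?_) hu
    filter_upwards [eventually_ge_atTop (b + s)] with t ht
    exact le_tsub_of_add_le_right ht
  refine ⟨R, mem_strongLimitPoints_iff.mpr ⟨u.map fun t => t - s, hsub, fun x => hR x⟩, hR1,
    fun x => isClosed_closure.mem_of_tendsto (hR x) (Eventually.of_forall fun t => hmem t x),
    fun x => ?_⟩
  refine (((T s).continuous.tendsto _).comp (hR x)).congr' ?_
  filter_upwards [hu (eventually_ge_atTop s)] with t ht
  simp only [Function.comp_apply]
  rw [← T.add_apply, add_tsub_cancel_of_le ht]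

theorem IsLocallyFinite.exists_idempotent (hT : T.IsLocallyFinite) :
    ∃ E ∈ T.strongLimitPoints, ‖E‖ ≤ 1 ∧ ∀ x, E (E x) = E x := by
  let u : Ultrafilter ℝ≥0 := Ultrafilter.of atTop
  have hu : ↑u ≤ (atTop : Filter ℝ≥0) := Ultrafilter.of_le _
  choose R hRmem hR1 hRK hR using hT.exists_shifted_limit hu
  obtain ⟨P, hP1, hP⟩ := exists_strong_limit u (fun t => T t) T.norm_le_one'
    fun x => ⟨_, hT x, fun t => subset_closure (Set.mem_range_self _)⟩
  have hPmem : P ∈ T.strongLimitPoints := mem_strongLimitPoints_iff.mpr ⟨u, hu, hP⟩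
  obtain ⟨E, hE1, hE⟩ := exists_strong_limit u R hR1 fun x => ⟨_, hT x, fun s => hRK s x⟩
  have hEmem : E ∈ T.strongLimitPoints := mem_strongLimitPoints_of_tendsto hRmem hE
  have hPE : ∀ x, P (E x) = P x := fun x => by
    refine tendsto_nhds_unique (hP (E x)) ?_
    have h1 : Tendsto (fun s => ‖E x - R s x‖) u (𝓝 0) := by
      simpa using ((tendsto_const_nhds (x := E x)).sub (hE x)).norm
    rw [tendsto_iff_norm_sub_tendsto_zero]
    refine squeeze_zero (fun _ => norm_nonneg _) (fun s => ?_) h1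
    -- Since `P x = T s (R s x)`, the difference is `T s (E x - R s x)`, and `T s` is a contraction.
    rw [tendsto_nhds_unique (hP x) (hR s x), ← map_sub]
    exact T.norm_apply_le _ _
  refine ⟨E, hEmem, hE1, fun x => ?_⟩
  rw [← sub_eq_zero, ← map_sub, apply_eq_zero_iff_tendsto hEmem, ← apply_eq_zero_iff_tendsto hPmem,
    map_sub, hPE, sub_self]

/-- The preimage is the shifted limit `R x`; it is fixed by `E` because strong limit points commute.
Its place in the orbit closure later makes backward orbits totally bounded. -/
theorem IsLocallyFinite.exists_apply_eq (hT : T.IsLocallyFinite) {E : X →L[ℂ] X}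
    (hE : E ∈ T.strongLimitPoints) {x : X} (hx : E x = x) (t : ℝ≥0) :
    ∃ z ∈ closure (Set.range fun t => T t x), E z = z ∧ T t z = x := by
  obtain ⟨u, hu, hEu⟩ := mem_strongLimitPoints_iff.mp hE
  obtain ⟨R, hRmem, -, hRK, hR⟩ := hT.exists_shifted_limit hu t
  exact ⟨R x, hRK x, by rw [strongLimitPoints_comm hRmem hE, hx],
    tendsto_nhds_unique (hR x) (by simpa only [hx] using hEu x)⟩

theorem eq_of_idempotent_mem_strongLimitPoints {E F : X →L[ℂ] X} (hE : E ∈ T.strongLimitPoints)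
    (hF : F ∈ T.strongLimitPoints) (hE2 : ∀ x, E (E x) = E x) (hF2 : ∀ x, F (F x) = F x) :
    E = F :=
  eq_of_commute_of_ker_eq hE2 hF2 (strongLimitPoints_comm hF hE) fun x => by
    rw [apply_eq_zero_iff_tendsto hE, apply_eq_zero_iff_tendsto hF]

/-- The semigroup `T_t E` for a contractive idempotent `E` commuting with `T`. -/
def compIdempotent (T : ContractionSemigroup X) (E : X →L[ℂ] X) (hE1 : ‖E‖ ≤ 1)
    (hE2 : ∀ x, E (E x) = E x) (hTE : ∀ t x, T t (E x) = E (T t x)) : ContractionSemigroup X where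
  toFun t := (T t).comp E
  map_add' s t := by
    ext x
    simp [T.add_apply, ← hTE, hE2]
  norm_le_one' t := ((T t).opNorm_comp_le E).trans
    (mul_le_one₀ (T.norm_le_one' t) (norm_nonneg _) hE1)
  continuous' x := T.continuous' (E x)

theorem isQuasiautomorphism_of_norm_map {Q : X →L[ℂ] X} (hQ : ‖Q‖ ≤ 1)
    (hiso : ∀ x, ‖Q (Q x)‖ = ‖Q x‖) (hsurj : ∀ x, ∃ z, Q (Q z) = Q x) :
    IsQuasiautomorphism Q := by
  let L : Q.range →ₗᵢ[ℂ] Q.range :=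
    { toLinearMap := (Q : X →ₗ[ℂ] X).restrict fun x _ => ⟨x, rfl⟩
      norm_map' := by
        rintro ⟨_, x, rfl⟩
        exact hiso x }
  refine ⟨hQ, LinearIsometryEquiv.ofSurjective L ?_, fun y => rfl⟩
  rintro ⟨_, x, rfl⟩
  obtain ⟨z, hz⟩ := hsurj x
  exact ⟨⟨Q z, z, rfl⟩, Subtype.ext hz⟩

/-- A semigroup of quasiautomorphisms is isometric on the range of its idempotent. -/
theorem norm_apply_apply_zero (hS : ∀ t, IsQuasiautomorphism (S t)) (t : ℝ≥0) (x : X) :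
    ‖S t (S 0 x)‖ = ‖S 0 x‖ := by
  have hiso : ∀ t x, ‖S t (S t x)‖ = ‖S t x‖ := fun t x => by
    obtain ⟨-, V, hV⟩ := hS t
    have h := V.norm_map ⟨S t x, x, rfl⟩
    exact (congrArg norm (hV ⟨S t x, x, rfl⟩)).symm.trans h
  have hrange : ∀ t x, ∃ z, S t x = S (t + t) z := fun t x => by
    obtain ⟨-, V, hV⟩ := hS t
    obtain ⟨⟨_, z, rfl⟩, hz⟩ := V.surjective ⟨S t x, x, rfl⟩
    refine ⟨z, ?_⟩
    rw [S.add_apply]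
    exact (congrArg Subtype.val hz).symm.trans (hV _)
  -- Doubling does not shrink the range, so every vector of the range of `S s` is reached at
  -- arbitrarily late times.
  have hpow : ∀ (n : ℕ) (s : ℝ≥0) (x : X), ∃ z, S s x = S (2 ^ n * s) z := by
    intro n
    induction n with
    | zero => exact fun s x => ⟨x, by simp⟩
    | succ n ih =>
      intro s x
      obtain ⟨z, hz⟩ := ih s x
      obtain ⟨w, hw⟩ := hrange (2 ^ n * s) z
      exact ⟨w, by rw [hz, hw]; ring_nf⟩
  have hpos : ∀ s : ℝ≥0, 0 < s → ‖S t (S s x)‖ = ‖S s x‖ := fun s hs => by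
    refine le_antisymm (S.norm_apply_le _ _) ?_
    -- With `t ≤ 2 ^ n * s`, the norm at time `t` is squeezed between the initial norm and the equal
    -- norm at time `2 ^ n * s`.
    obtain ⟨n, hn⟩ := pow_unbounded_of_one_lt (t / s) (one_lt_two (α := ℝ≥0))
    obtain ⟨z, hz⟩ := hpow n s x
    rw [div_lt_iff₀ hs] at hn
    rw [hz]
    conv_lhs => rw [← hiso]
    exact S.antitone_norm_apply _ hn.le
  -- Doubling says nothing at `s = 0`, which is reached by strong continuity.
  have hne : (𝓝[>] (0 : ℝ≥0)).NeBot := inferInstance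
  have hlim : Tendsto (fun s => S s x) (𝓝[>] 0) (𝓝 (S 0 x)) :=
    ((S.continuous' x).tendsto 0).mono_left nhdsWithin_le_nhds
  refine tendsto_nhds_unique ((((S t).continuous.tendsto _).comp hlim).norm) (hlim.norm.congr' ?_)
  filter_upwards [self_mem_nhdsWithin] with s hs
  exact (hpos s hs).symm

/-- `S` has constant norm along orbits from time 0, so `S 0 x = 0` exactly when `T t x` tends to 0,
which is the kernel of `E`. -/
theorem zero_eq_and_eq_comp (hS : ∀ t, IsQuasiautomorphism (S t))
    (hTS : ∀ x, Tendsto (fun t => ‖T t x - S t x‖) atTop (𝓝 0)) {E : X →L[ℂ] X}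
    (hE : E ∈ T.strongLimitPoints) (hE2 : ∀ x, E (E x) = E x) :
    S 0 = E ∧ ∀ t, S t = (T t).comp E := by
  have hTS0 : ∀ x, Tendsto (fun t => T t x - S t x) atTop (𝓝 0) := fun x =>
    tendsto_zero_iff_norm_tendsto_zero.mpr (hTS x)
  have hS0 : ∀ t x, S t (S 0 x) = S t x := fun t x => by rw [← S.add_apply, add_zero]
  obtain ⟨u, hu, hEu⟩ := mem_strongLimitPoints_iff.mp hE
  have hESu : ∀ x, Tendsto (fun t => S t x) u (𝓝 (E x)) := fun x => by
    simpa using (hEu x).sub ((hTS0 x).mono_left hu)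
  have hES : ∀ s x, S s (E x) = E (S s x) :=
    fun s => apply_comm_of_mem_strongLimitPoints (mem_strongLimitPoints_iff.mpr ⟨u, hu, hESu⟩)
      (S.apply_comm s)
  have h0 : S 0 = E := by
    refine eq_of_commute_of_ker_eq (hS0 0) hE2 (hES 0) fun x => ?_
    rw [apply_eq_zero_iff_tendsto hE]
    refine ⟨fun h => ?_, fun h => ?_⟩
    · refine (hTS0 x).congr fun t => ?_
      rw [← hS0, h, map_zero, sub_zero]
    · have h1 : Tendsto (fun t => ‖S t x‖) atTop (𝓝 0) := by
        simpa using (h.sub (hTS0 x)).norm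
      have h2 : ∀ t, ‖S t x‖ = ‖S 0 x‖ := fun t => by rw [← hS0, norm_apply_apply_zero hS]
      simp_rw [h2] at h1
      exact norm_eq_zero.mp (tendsto_nhds_unique tendsto_const_nhds h1)
  refine ⟨h0, fun s => ?_⟩
  ext x
  rw [← hS0, h0]
  have hadd : Tendsto (fun t : ℝ≥0 => s + t) u atTop :=
    (tendsto_atTop_mono (fun t => le_add_self) tendsto_id).mono_left hu
  have h1 : Tendsto (fun t => T (s + t) x - S (s + t) x) u (𝓝 (T s (E x) - S s (E x))) := by
    simp_rw [T.add_apply, S.add_apply]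
    exact (((T s).continuous.tendsto _).comp (hEu x)).sub
      (((S s).continuous.tendsto _).comp (hESu x))
  exact (sub_eq_zero.mp (tendsto_nhds_unique h1 ((hTS0 x).comp hadd))).symm

theorem IsLocallyFinite.existsUnique_quasiautomorphism (hT : T.IsLocallyFinite) :
    ∃! S : ContractionSemigroup X, (∀ t, IsQuasiautomorphism (S t)) ∧
      ∀ x, Tendsto (fun t => ‖T t x - S t x‖) atTop (𝓝 0) := by
  obtain ⟨E, hE, hE1, hE2⟩ := hT.exists_idempotent
  have hTE : ∀ t x, T t (E x) = E (T t x) := fun t =>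
    apply_comm_of_mem_strongLimitPoints hE (T.apply_comm t)
  have hval : ∀ t x, T.compIdempotent E hE1 hE2 hTE t x = T t (E x) := fun _ _ => rfl
  refine ⟨T.compIdempotent E hE1 hE2 hTE, ⟨fun t => ?_, fun x => ?_⟩, ?_⟩
  · refine isQuasiautomorphism_of_norm_map (norm_le_one' _ t) (fun x => ?_) fun x => ?_
    · have h : E (T t (E x)) = T t (E x) := by rw [← hTE, hE2]
      rw [hval, hval, h, norm_apply_eq_of_mem_strongLimitPoints hE h]
    · obtain ⟨z, -, hz, hz'⟩ := hT.exists_apply_eq hE (hE2 x) t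
      refine ⟨z, ?_⟩
      rw [hval, hval, hz, hval, hz', hE2]
  · have h := (apply_eq_zero_iff_tendsto hE (x - E x)).mp (by rw [map_sub, hE2, sub_self])
    simpa [hval] using h.norm
  · rintro S ⟨hS, hTS⟩
    have h := (zero_eq_and_eq_comp hS hTS hE hE2).2
    cases S
    unfold compIdempotent
    congr
    exact funext h

end ContractionSemigroup

/-! ### Generators and eigenvectors -/

namespace ContractionSemigroup

section Generator

variable {X : Type*} [NormedAddCommGroup X] [NormedSpace ℂ X] {T : ContractionSemigroup X}

theorem generator_apply_eq_iff {x y : X} (hx : x ∈ T.generator.domain) :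
    T.generator ⟨x, hx⟩ = y ↔ T.HasGeneratorValue x y := by
  have h : T.HasGeneratorValue x (T.generator ⟨x, hx⟩) := Classical.choose_spec hx
  exact ⟨fun hy => hy ▸ h, fun hy => h.unique hy⟩

theorem mem_domain_generator {x y : X} (h : T.HasGeneratorValue x y) :
    x ∈ T.generator.domain := ⟨y, h⟩

theorem tendsto_coe_nhdsGT_zero :
    Tendsto ((↑) : ℝ≥0 → ℝ) (𝓝[>] 0) (𝓝[>] 0) := by
  refine tendsto_nhdsWithin_iff.mpr ⟨?_, ?_⟩
  · exact (NNReal.continuous_coe.tendsto' 0 0 rfl).mono_left nhdsWithin_le_nhds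
  · filter_upwards [self_mem_nhdsWithin] with t ht
    exact NNReal.coe_pos.mpr ht

/-- A vector on which the semigroup acts by scalars that are differentiable at `0` lies in the
domain of the generator. -/
theorem hasGeneratorValue_of_hasDerivAt {x : X} {c : ℝ → ℂ} {z : ℂ} (hc0 : c 0 = 1)
    (hc : HasDerivAt c (Complex.I * z) 0) (hx : ∀ t : ℝ≥0, T t x = c t • x) :
    T.HasGeneratorValue x (z • x) := by
  have h1 : Tendsto (fun t : ℝ≥0 => slope c 0 (t : ℝ)) (𝓝[>] 0) (𝓝 (Complex.I * z)) :=
    (hasDerivAt_iff_tendsto_slope.mp hc).comp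
      (tendsto_coe_nhdsGT_zero.mono_right (nhdsWithin_mono _ fun t ht => ne_of_gt ht))
  have h2 := (h1.const_mul (-Complex.I)).smul_const x
  rw [← mul_assoc, neg_mul, Complex.I_mul_I, neg_neg, one_mul] at h2
  refine h2.congr fun t => ?_
  have h3 : c t • x - x = (c t - 1) • x := by rw [sub_smul, one_smul]
  rw [hx, h3, smul_smul]
  congr 1
  simp [slope_def_module, hc0, Complex.inv_I]
  ring

theorem IsEigenvector.hasGeneratorValue {x : X} {z : ℂ} (h : T.IsEigenvector z x) :
    T.HasGeneratorValue x (z • x) := by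
  refine hasGeneratorValue_of_hasDerivAt
    (c := fun t : ℝ => Complex.exp (Complex.I * (t : ℂ) * z)) (by simp) ?_ h.2
  have h1 : HasDerivAt (fun t : ℝ => Complex.I * (t : ℂ) * z) (Complex.I * z) 0 := by
    simpa using ((Complex.ofRealCLM.hasDerivAt (x := 0)).const_mul Complex.I).mul_const z
  simpa using h1.cexp

/-- The semigroup law turns the generator value at 0 into a right derivative at every time, so `exp
(-(I * r * z)) • T r x` has zero right derivative and is constant. -/
theorem HasGeneratorValue.apply_eq (hT0 : ∀ x, T 0 x = x) {x : X} {z : ℂ}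
    (h : T.HasGeneratorValue x (z • x)) (t : ℝ≥0) :
    T t x = Complex.exp (Complex.I * ((t : ℝ) : ℂ) * z) • x := by
  have hderiv : ∀ s : ℝ, 0 ≤ s → HasDerivWithinAt (fun r : ℝ => T r.toNNReal x)
      ((Complex.I * z) • T s.toNNReal x) (Set.Ici s) s := fun s hs => by
    rw [← hasDerivWithinAt_Ioi_iff_Ici, hasDerivWithinAt_iff_tendsto_slope' (by simp)]
    have hsub : Tendsto (fun r : ℝ => (r - s).toNNReal) (𝓝[>] s) (𝓝[>] 0) := by
      refine tendsto_nhdsWithin_iff.mpr ⟨?_, ?_⟩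
      · exact (Continuous.tendsto' (by fun_prop) s 0 (by simp)).mono_left nhdsWithin_le_nhds
      · filter_upwards [self_mem_nhdsWithin] with r hr
        exact Real.toNNReal_pos.mpr (sub_pos.mpr hr)
    have h1 := (((T s.toNNReal).continuous.tendsto _).comp (h.comp hsub)).const_smul Complex.I
    rw [map_smul, smul_smul] at h1
    refine h1.congr' ?_
    filter_upwards [self_mem_nhdsWithin] with r hr
    have hr' : s < r := hr
    have h2 : T r.toNNReal x = T s.toNNReal (T (r - s).toNNReal x) := by
      rw [← T.add_apply, ← Real.toNNReal_add hs (sub_nonneg.mpr hr'.le), add_sub_cancel]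
    simp only [Function.comp_apply]
    rw [map_smul, smul_smul, map_sub, ← h2, Real.coe_toNNReal _ (sub_nonneg.mpr hr'.le), slope,
      vsub_eq_sub, ← Complex.coe_smul]
    congr 1
    simp only [Complex.ofReal_inv, Complex.ofReal_sub, mul_inv, Complex.inv_I]
    linear_combination -((r : ℂ) - s)⁻¹ * Complex.I_mul_I
  have hcont : Continuous fun r : ℝ => T r.toNNReal x := (T.continuous' x).comp (by fun_prop)
  have hexp : ∀ s : ℝ, HasDerivAt (fun r : ℝ => Complex.exp (-(Complex.I * (r : ℂ) * z)))
      (Complex.exp (-(Complex.I * (s : ℂ) * z)) * -(Complex.I * z)) s := fun s => by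
    have h1 : HasDerivAt (fun r : ℝ => Complex.I * (r : ℂ) * z) (Complex.I * z) s := by
      simpa using ((Complex.ofRealCLM.hasDerivAt (x := s)).const_mul Complex.I).mul_const z
    exact h1.neg.cexp
  have hconst := constant_of_has_deriv_right_zero (a := 0) (b := (t : ℝ))
    (f := fun r : ℝ => Complex.exp (-(Complex.I * (r : ℂ) * z)) • T r.toNNReal x)
    (Continuous.continuousOn (by fun_prop))
    (fun s hs => by
      have h1 := (hexp s).hasDerivWithinAt (s := Set.Ici s) |>.smul (hderiv s hs.1)
      refine h1.congr_deriv ?_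
      rw [smul_smul, ← add_smul]
      simp)
    t ⟨t.2, le_rfl⟩
  simp only [Real.toNNReal_coe, Complex.ofReal_zero, mul_zero, zero_mul, neg_zero, Complex.exp_zero,
    Real.toNNReal_zero, one_smul, hT0] at hconst
  conv_rhs => rw [← hconst]
  rw [smul_smul, ← Complex.exp_add, add_neg_cancel, Complex.exp_zero, one_smul]

theorem pointSpectrum_generator (hT0 : ∀ x, T 0 x = x) :
    T.generator.pointSpectrum = T.pointSpectrum := by
  ext z
  constructor
  · rintro ⟨⟨x, hx⟩, hx0, h⟩
    refine ⟨x, fun h0 => hx0 (Subtype.ext h0), fun t => ?_⟩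
    exact ((generator_apply_eq_iff hx).mp h).apply_eq hT0 t
  · rintro ⟨x, hx⟩
    have h := hx.hasGeneratorValue
    exact ⟨⟨x, mem_domain_generator h⟩, fun h0 => hx.1 (congrArg Subtype.val h0),
      (generator_apply_eq_iff _).mpr h⟩

/-- A common eigenvector of all operators of a semigroup is an eigenvector of the semigroup. -/
theorem exists_isEigenvector (hT0 : ∀ x, T 0 x = x) {x : X} (hx : x ≠ 0)
    (h : ∀ t, ∃ c : ℂ, T t x = c • x) : ∃ z, T.IsEigenvector z x := by
  choose c hc using h
  obtain ⟨ψ, -, hψ⟩ := exists_dual_vector ℂ x (norm_ne_zero_iff.mpr hx)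
  have hψ0 : ψ x ≠ 0 := by
    rw [hψ]
    exact Complex.ofReal_ne_zero.mpr (norm_ne_zero_iff.mpr hx)
  have hcψ : ∀ t, c t = ψ (T t x) / ψ x := fun t => by
    rw [hc, map_smul, smul_eq_mul, mul_div_cancel_right₀ _ hψ0]
  have hcont : Continuous c := by
    have h := (ψ.continuous.comp (T.continuous' x)).div_const (ψ x)
    exact h.congr fun t => (hcψ t).symm
  have hc0 : c 0 = 1 := by rw [hcψ, hT0, div_self hψ0]
  have hadd : ∀ s t, c (s + t) = c s * c t := fun s t => by
    rw [hcψ, T.add_apply, hc t, map_smul, hc s, smul_smul, map_smul, smul_eq_mul,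
      mul_div_cancel_right₀ _ hψ0, mul_comm]
  let g : ℝ → ℂ := fun t => c t.toNNReal
  have hg : Continuous g := hcont.comp (by fun_prop)
  -- The scalars `c` are only known to be continuous. Integrating `c (t + s) = c t * c s` over `s ∈
  -- [0, δ]`, with `F δ ≠ 0`, expresses `c` through the differentiable function `F`.
  let F : ℝ → ℂ := fun t => ∫ s in (0 : ℝ)..t, g s
  have hF : ∀ t, HasDerivAt F (g t) t := fun t => hg.integral_hasStrictDerivAt 0 t |>.hasDerivAt
  obtain ⟨δ, hδF, hδ⟩ : ∃ δ, F δ ≠ 0 ∧ 0 < δ := by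
    have h1 : ∀ᶠ t in 𝓝[>] (0 : ℝ), F t ≠ 0 :=
      ((hF 0).eventually_ne (by simp [g, hc0])).filter_mono
        (nhdsWithin_mono _ fun t ht => ne_of_gt ht)
    exact (h1.and self_mem_nhdsWithin).exists
  have hcF : ∀ t : ℝ≥0, c t = (F (t + δ) - F t) / F δ := fun t => by
    rw [eq_div_iff hδF, intervalIntegral.integral_interval_sub_left
      (hg.intervalIntegrable _ _) (hg.intervalIntegrable _ _)]
    have h1 := intervalIntegral.integral_comp_add_left (a := 0) (b := δ) g (t : ℝ)
    rw [add_zero] at h1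
    rw [← h1, ← intervalIntegral.integral_const_mul]
    refine intervalIntegral.integral_congr fun s hs => ?_
    rw [Set.uIcc_of_le hδ.le] at hs
    change c t * c s.toNNReal = c (t + s).toNNReal
    rw [Real.toNNReal_add t.coe_nonneg hs.1, Real.toNNReal_coe, hadd]
  have hderiv : HasDerivAt (fun t : ℝ => (F (t + δ) - F t) / F δ)
      ((g (0 + δ) - g 0) / F δ) 0 :=
    (((hF (0 + δ)).comp_add_const 0 δ).sub (hF 0)).div_const _
  have hgen := hasGeneratorValue_of_hasDerivAt (T := T) (x := x)
    (c := fun t : ℝ => (F (t + δ) - F t) / F δ)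
    (z := -Complex.I * ((g (0 + δ) - g 0) / F δ))
    (by rw [← hc0, hcF 0, NNReal.coe_zero])
    (by simpa [← mul_assoc] using hderiv) fun t => by rw [hc, hcF]
  exact ⟨_, hx, hgen.apply_eq hT0⟩

theorem IsEigenvector.norm_apply {x : X} {z : ℂ} (h : T.IsEigenvector z x) (t : ℝ≥0) :
    ‖T t x‖ = Real.exp (-(t * z.im)) * ‖x‖ := by
  rw [h.2, norm_smul, Complex.norm_exp]
  simp [Complex.mul_re, Complex.mul_im]

theorem IsEigenvector.im_eq_zero_iff {x : X} {z : ℂ} (h : T.IsEigenvector z x) :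
    z.im = 0 ↔ ∀ t, ‖T t x‖ = ‖x‖ := by
  refine ⟨fun hz t => by simp [h.norm_apply, hz], fun hz => ?_⟩
  have h1 := hz 1
  rw [h.norm_apply, mul_eq_right₀ (norm_ne_zero_iff.mpr h.1), Real.exp_eq_one_iff] at h1
  simpa using h1

theorem mem_range_ofReal_iff {z : ℂ} : z ∈ Set.range ((↑) : ℝ → ℂ) ↔ z.im = 0 := by
  refine ⟨?_, fun h => ⟨z.re, Complex.ext (by simp) (by simp [h])⟩⟩
  rintro ⟨r, rfl⟩
  simp

theorem isDiagonalizedBy_maximalEigenvectors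
    (h : (Submodule.span ℂ T.maximalEigenvectors).topologicalClosure = ⊤) :
    T.generator.IsDiagonalizedBy T.maximalEigenvectors :=
  ⟨fun _ ⟨⟨z, hz⟩, _⟩ => ⟨hz.1, mem_domain_generator hz.hasGeneratorValue, z,
    (generator_apply_eq_iff _).mpr hz.hasGeneratorValue⟩, h⟩

end Generator

/-! ### From isometric semigroups to groups -/

section AutomorphismGroup

variable {Y : Type*} [NormedAddCommGroup Y] [NormedSpace ℂ Y]

/-- The extension to `ℝ` of a semigroup of automorphisms. -/
noncomputable def extendReal (V : ℝ≥0 → Y ≃ₗᵢ[ℂ] Y) (a : ℝ) : Y ≃ₗᵢ[ℂ] Y :=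
  V a.toNNReal * (V (-a).toNNReal)⁻¹

theorem extendReal_add {V : ℝ≥0 → Y ≃ₗᵢ[ℂ] Y} (hV : ∀ s t, V (s + t) = V s * V t) (a b : ℝ) :
    extendReal V (a + b) = extendReal V a * extendReal V b := by
  have hcomm : ∀ s t, Commute (V s) (V t) := fun s t => by
    rw [commute_iff_eq, ← hV, ← hV, add_comm]
  -- Additivity of positive minus negative parts, rearranged to avoid subtraction in `ℝ≥0`.
  have key : (a + b).toNNReal + ((-a).toNNReal + (-b).toNNReal) =
      (a.toNNReal + b.toNNReal) + (-(a + b)).toNNReal := by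
    have h := fun x : ℝ => max_zero_sub_eq_self x
    ext
    push_cast [Real.coe_toNNReal']
    have h1 := h a
    have h2 := h b
    have h3 := h (a + b)
    linarith
  have h1 := congrArg V key
  simp only [hV] at h1
  unfold extendReal
  rw [mul_inv_eq_iff_eq_mul]
  have h2 : V a.toNNReal * (V (-a).toNNReal)⁻¹ * (V b.toNNReal * (V (-b).toNNReal)⁻¹) *
      V (-(a + b)).toNNReal = V a.toNNReal * V b.toNNReal * V (-(a + b)).toNNReal *
      (V (-b).toNNReal)⁻¹ * (V (-a).toNNReal)⁻¹ := by
    have c1 := ((hcomm (-a).toNNReal b.toNNReal).inv_left).eq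
    have c2 := ((hcomm (-a).toNNReal (-(a + b)).toNNReal).inv_left).eq
    have c3 := ((hcomm (-b).toNNReal (-(a + b)).toNNReal).inv_left).eq
    have c4 := ((hcomm (-a).toNNReal (-b).toNNReal).inv_inv).eq
    simp only [mul_assoc]
    rw [c3, ← mul_assoc (V (-a).toNNReal)⁻¹, c1, mul_assoc, ← mul_assoc (V (-a).toNNReal)⁻¹, c2,
      mul_assoc, c4]
  rw [h2, ← h1]
  group

theorem extendReal_coe {V : ℝ≥0 → Y ≃ₗᵢ[ℂ] Y} (hV : ∀ s t, V (s + t) = V s * V t) (t : ℝ≥0) :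
    extendReal V t = V t := by
  have h0 : V 0 = 1 := by
    have h := hV 0 0
    rwa [add_zero, left_eq_mul] at h
  simp [extendReal, Real.toNNReal_of_nonpos (neg_nonpos.mpr t.coe_nonneg), h0]

variable [CompleteSpace Y]

/-- A semigroup of automorphisms with relatively compact orbits has a dense span of maximal
eigenvectors. -/
theorem topologicalClosure_span_maximalEigenvectors {U : ContractionSemigroup Y}
    {V : ℝ≥0 → Y ≃ₗᵢ[ℂ] Y} (hV : ∀ t y, V t y = U t y) {K : Y → Set Y}
    (hK : ∀ y, TotallyBounded (K y)) (hUK : ∀ t y, U t y ∈ K y)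
    (hVK : ∀ t y, (V t).symm y ∈ K y) :
    (Submodule.span ℂ U.maximalEigenvectors).topologicalClosure = ⊤ := by
  have hVadd : ∀ s t, V (s + t) = V s * V t := fun s t => by
    ext y
    change V (s + t) y = V s (V t y)
    rw [hV, hV, hV, U.add_apply]
  have hV0 : V 0 = 1 := by
    have h := hVadd 0 0
    rwa [add_zero, left_eq_mul] at h
  have hU0 : ∀ y, U 0 y = y := fun y => by rw [← hV, hV0, LinearIsometryEquiv.coe_one, id]
  rw [eq_top_iff]
  rintro y -
  have h := mem_closure_span_common_eigenvectors (extendReal V)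
    (fun a b x => by rw [extendReal_add hVadd, LinearIsometryEquiv.coe_mul, Function.comp_apply]) y
    -- The two-sided orbit consists of forward values of `U` and values of the inverses, all in `K
    -- y`.
    ((hK y).subset (by
      rintro _ ⟨a, rfl⟩
      rcases le_total 0 a with ha | ha
      · simpa [extendReal, Real.toNNReal_of_nonpos (neg_nonpos.mpr ha), hV0, hV] using hUK _ y
      · simpa [extendReal, Real.toNNReal_of_nonpos ha, hV0] using hVK _ y))
  refine Submodule.topologicalClosure_mono (Submodule.span_le.mpr fun v hv => ?_) h
  by_cases hv0 : v = 0
  · rw [hv0]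
    exact Submodule.zero_mem _
  · refine Submodule.subset_span ⟨exists_isEigenvector hU0 hv0 fun t => ?_, fun t => ?_⟩
    · obtain ⟨c, hc⟩ := hv t
      exact ⟨c, by rw [← hc, extendReal_coe hVadd, hV]⟩
    · rw [← hV, (V t).norm_map]

end AutomorphismGroup

end ContractionSemigroup

/-! ### The restriction to the range of the idempotent -/

namespace ContractionSemigroup

variable {X : Type*} [NormedAddCommGroup X] [NormedSpace ℂ X] {T S : ContractionSemigroup X}

theorem onRange_apply_coe (t : ℝ≥0) (y : (S 0).range) : (S.onRange t y : X) = S t y := rfl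

theorem apply_coe_range_zero (y : (S 0).range) : S 0 y = y := by
  obtain ⟨_, x, rfl⟩ := y
  change S 0 (S 0 x) = S 0 x
  rw [← S.add_apply, add_zero]

theorem onRange_zero_apply (y : (S 0).range) : S.onRange 0 y = y :=
  Subtype.ext (apply_coe_range_zero y)

theorem isEigenvector_onRange_iff {z : ℂ} {y : (S 0).range} :
    S.onRange.IsEigenvector z y ↔ S.IsEigenvector z (y : X) := by
  simp only [IsEigenvector, ne_eq, ZeroMemClass.coe_eq_zero, Subtype.ext_iff, onRange_apply_coe,
    Submodule.coe_smul]

theorem apply_coe_range_zero_of_eq_comp (hS : ∀ t, S t = (T t).comp (S 0)) (t : ℝ≥0)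
    (y : (S 0).range) : S t y = T t y := by
  rw [hS, ContinuousLinearMap.comp_apply, apply_coe_range_zero]

theorem IsLocallyFinite.exists_automorphism_onRange (hT : T.IsLocallyFinite)
    (hE : S 0 ∈ T.strongLimitPoints) (hS : ∀ t, S t = (T t).comp (S 0)) (t : ℝ≥0) :
    ∃ V : (S 0).range ≃ₗᵢ[ℂ] (S 0).range, (∀ y, V y = S.onRange t y) ∧
      ∀ y : (S 0).range, (V.symm y : X) ∈ closure (Set.range fun t => T t (y : X)) := by
  have hSy : ∀ y : (S 0).range, S t y = T t y :=
    apply_coe_range_zero_of_eq_comp hS t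
  let L : (S 0).range →ₗᵢ[ℂ] (S 0).range :=
    { toLinearMap := S.onRange t
      norm_map' := fun y => by
        change ‖S t (y : X)‖ = ‖(y : X)‖
        rw [hSy]
        exact norm_apply_eq_of_mem_strongLimitPoints hE (apply_coe_range_zero y) t }
  have hL : ∀ y : (S 0).range, ∃ z, L z = y ∧
      (z : X) ∈ closure (Set.range fun t => T t (y : X)) := fun y => by
    obtain ⟨z, hzK, hz, hzy⟩ := hT.exists_apply_eq hE (apply_coe_range_zero y) t
    exact ⟨⟨z, z, hz⟩, Subtype.ext ((hSy ⟨z, z, hz⟩).trans hzy), hzK⟩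
  refine ⟨LinearIsometryEquiv.ofSurjective L fun y => (hL y).imp fun z hz => hz.1, fun y => rfl,
    fun y => ?_⟩
  obtain ⟨z, rfl, hz⟩ := hL y
  have h : (LinearIsometryEquiv.ofSurjective L fun y => (hL y).imp fun z hz => hz.1).symm (L z) =
      z := LinearIsometryEquiv.symm_apply_apply _ z
  rw [h]
  exact hz

theorem completeSpace_range_zero [CompleteSpace X] : CompleteSpace (S 0).range := by
  have h : ((S 0).range : Set X) = {x | S 0 x = x} :=
    Set.ext fun x => ⟨fun hx => apply_coe_range_zero ⟨x, hx⟩, fun hx => ⟨x, hx⟩⟩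
  have hclosed : IsClosed ((S 0).range : Set X) := by
    rw [h]
    exact isClosed_eq (S 0).continuous continuous_id
  exact hclosed.completeSpace_coe

theorem IsLocallyFinite.isDiagonalizedBy_onRange [CompleteSpace X] (hT : T.IsLocallyFinite)
    (hE : S 0 ∈ T.strongLimitPoints) (hS : ∀ t, S t = (T t).comp (S 0)) :
    S.onRange.generator.IsDiagonalizedBy S.onRange.maximalEigenvectors := by
  have := completeSpace_range_zero (S := S)
  choose V hV hVK using hT.exists_automorphism_onRange hE hS
  refine isDiagonalizedBy_maximalEigenvectors (topologicalClosure_span_maximalEigenvectors hV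
    (K := fun y => ((↑) : (S 0).range → X) ⁻¹' closure (Set.range fun t => T t (y : X)))
    (fun y => totallyBounded_preimage isometry_subtype_coe.isUniformInducing
      (hT y).totallyBounded) (fun t y => subset_closure ⟨t, ?_⟩) hVK)
  exact (apply_coe_range_zero_of_eq_comp hS t y).symm

/-- A maximal eigenvector of `T` is fixed by every idempotent strong limit point. -/
theorem apply_eq_of_norm_apply_eq {E : X →L[ℂ] X} (hE : E ∈ T.strongLimitPoints)
    (hE2 : ∀ x, E (E x) = E x) {x : X} {z : ℂ} (hx : T.IsEigenvector z x) (hz : z.im = 0) :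
    E x = x := by
  -- The defect `E x - x` decays under `T`; if nonzero, it would be an eigenvector with real
  -- eigenvalue, whose norm stays constant.
  have h1 := (apply_eq_zero_iff_tendsto hE (E x - x)).mp (by rw [map_sub, hE2, sub_self])
  by_contra hne
  have h2 : T.IsEigenvector z (E x - x) := ⟨sub_ne_zero.mpr hne, fun t => by
    rw [map_sub, apply_comm_of_mem_strongLimitPoints hE (T.apply_comm t), hx.2, map_smul,
      smul_sub]⟩
  have h3 := h1.norm
  simp_rw [h2.im_eq_zero_iff.mp hz, norm_zero] at h3
  exact h2.1 (norm_eq_zero.mp (tendsto_nhds_unique tendsto_const_nhds h3))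

end ContractionSemigroup

/-! ### The main theorem -/

theorem theorem6p1 {X : Type*} [NormedAddCommGroup X] [NormedSpace ℂ X] [CompleteSpace X]
    (T : ContractionSemigroup X) (hT : T.IsLocallyFinite)
    (hT0 : T 0 = ContinuousLinearMap.id ℂ X) :
    -- existence and uniqueness of `S`
    (∃! S : ContractionSemigroup X, (∀ t, IsQuasiautomorphism (S t)) ∧
      ∀ x, Tendsto (fun t => ‖T t x - S t x‖) atTop (𝓝 0)) ∧
    -- the properties of this `S`, with `E = S 0` and `U = S.onRange`
    ∀ S : ContractionSemigroup X, (∀ t, IsQuasiautomorphism (S t)) →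
      (∀ x, Tendsto (fun t => ‖T t x - S t x‖) atTop (𝓝 0)) →
      -- the polar decomposition `S_t = U_t E`, with `U_t` an automorphism of `EX = S_t X`
      (∀ t x, S t x = S.onRange t ⟨S 0 x, x, rfl⟩) ∧
      (∀ t, (S t).range = (S 0).range) ∧
      (∀ t, ∃ V : (S 0).range ≃ₗᵢ[ℂ] (S 0).range, ∀ y, V y = S.onRange t y) ∧
      -- diagonalization of the generator of `U` by the maximal eigenvectors
      S.onRange.generator.IsDiagonalizedBy S.onRange.maximalEigenvectors ∧
      Subtype.val '' S.onRange.maximalEigenvectors = T.maximalEigenvectors ∧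
      -- the point spectrum
      S.onRange.generator.pointSpectrum = S.onRange.pointSpectrum ∧
      S.onRange.pointSpectrum = T.pointSpectrum ∩ Set.range ((↑) : ℝ → ℂ) ∧
      -- `E` is the unique idempotent strong limit point
      (∀ F : X →L[ℂ] X, (F ∈ T.strongLimitPoints ∧ IsIdempotentElem F) ↔ F = S 0) ∧
      -- `U_t` is the restriction of `T_t`, and `S_t = T_t E`
      (∀ t, ∀ y : (S 0).range, (S.onRange t y : X) = T t y) ∧
      ∀ t, S t = (T t).comp (S 0) := by
  refine ⟨hT.existsUnique_quasiautomorphism, fun S hSq hTS => ?_⟩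
  obtain ⟨E, hE, -, hE2⟩ := hT.exists_idempotent
  -- Any admissible `S` has `S 0 = E`, so the facts about `E` become facts about `S 0`.
  obtain ⟨rfl, hS⟩ := ContractionSemigroup.zero_eq_and_eq_comp hSq hTS hE hE2
  have hS0 : ∀ t x, S t (S 0 x) = S t x := fun t x => by rw [← S.add_apply, add_zero]
  have hST : ∀ t, ∀ y : (S 0).range, S t y = T t y :=
    ContractionSemigroup.apply_coe_range_zero_of_eq_comp hS
  have hiso : ∀ t, ∀ y : (S 0).range, ‖S.onRange t y‖ = ‖y‖ := fun t y =>
    (congrArg norm (hST t y)).trans (ContractionSemigroup.norm_apply_eq_of_mem_strongLimitPoints hE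
      (ContractionSemigroup.apply_coe_range_zero y) t)
  have heig : ∀ z, ∀ y : (S 0).range, S.onRange.IsEigenvector z y ↔ T.IsEigenvector z (y : X) :=
    fun z y => by
      rw [ContractionSemigroup.isEigenvector_onRange_iff]
      simp only [ContractionSemigroup.IsEigenvector, hST]
  have hfix : ∀ {z x}, T.IsEigenvector z x → z.im = 0 → S 0 x = x :=
    ContractionSemigroup.apply_eq_of_norm_apply_eq hE hE2
  refine ⟨fun t x => (hS0 t x).symm, fun t => le_antisymm ?_ ?_, fun t => ?_,
    hT.isDiagonalizedBy_onRange hE hS, ?_,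
    ContractionSemigroup.pointSpectrum_generator ContractionSemigroup.onRange_zero_apply, ?_,
    fun F => ⟨fun hF => ?_, ?_⟩, hST, hS⟩
  · rintro _ ⟨x, rfl⟩
    exact ⟨S t x, (S.apply_comm 0 t x).trans (hS0 t x)⟩
  · rintro _ ⟨x, rfl⟩
    obtain ⟨z, -, hz, hzx⟩ := hT.exists_apply_eq hE (hE2 x) t
    exact ⟨z, (congrArg (S t) hz.symm).trans ((hST t ⟨S 0 z, z, rfl⟩).trans
      ((congrArg (T t) hz).trans hzx))⟩
  · obtain ⟨V, hV, -⟩ := hT.exists_automorphism_onRange hE hS t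
    exact ⟨V, hV⟩
  · ext x
    constructor
    · rintro ⟨y, ⟨⟨z, hz⟩, hy⟩, rfl⟩
      exact ⟨⟨z, (heig z y).mp hz⟩, fun t => (congrArg norm (hST t y)).symm.trans (hy t)⟩
    · rintro ⟨⟨z, hz⟩, hx⟩
      have h := hfix hz (hz.im_eq_zero_iff.mpr hx)
      exact ⟨⟨x, x, h⟩, ⟨⟨z, (heig z _).mpr hz⟩, fun t => hiso t _⟩, rfl⟩
  · ext z
    rw [Set.mem_inter_iff, ContractionSemigroup.mem_range_ofReal_iff]
    constructor
    · rintro ⟨y, hy⟩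
      exact ⟨⟨y, (heig z y).mp hy⟩, hy.im_eq_zero_iff.mpr fun t => hiso t y⟩
    · rintro ⟨⟨x, hx⟩, hz⟩
      exact ⟨⟨x, x, hfix hx hz⟩, (heig z _).mpr hx⟩
  · exact ContractionSemigroup.eq_of_idempotent_mem_strongLimitPoints hF.1 hE
      (fun x => DFunLike.congr_fun hF.2 x) hE2
  · rintro rfl
    exact ⟨hE, ContinuousLinearMap.ext hE2⟩
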